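/- Fix $n$ and write $X^g=gXg^{-1}$. Inside $\mathrm{SL}(n,\mathbb C)$ let $\mathrm K$ be the special unitary group, $\mathrm U$ the group of upper triangular matrices with strictly positive diagonal entries, and $\mathrm L$ the group of lower triangular matrices with diagonal entries equal to $1$. Every $g\in \mathrm{SL}(n,\mathbb C)$ factors uniquely as $g=\kappa(g)\nu(g)$ with $\kappa(g)\in\mathrm K$, $\nu(g)\in\mathrm U$. Put $$\mathcal C=\{k\in\mathrm K : k=lu \text{ for some } l\in\mathrm L,\ u\in\mathrm U\},\qquad \mathcal D=\{u\in\mathrm U : l=ku\text{ for some } l\in\mathrm L,\ k\in\mathrm K\}=\nu(\mathrm L).$$ Let $\mathfrak k$ and $\mathfrak u$ be the Lie algebras of $\mathrm K$ and $\mathrm U$, let $\pi_{\mathfrak k}$ be the projection onto $\mathfrak k$ in $\mathfrak{sl}(n,\mathbb C)=\mathfrak k\oplus\mathfrak u$, and let $\mathfrak l$ be the space of strictly lower triangular matrices. The Toda vector field is $X'=[X,\pi_{\mathfrak k}X]$. Let $\mathcal O\subset\mathfrak{sl}(n,\mathbb C)$ be a conjugacy class of matrices with simple spectrum, let $\Lambda\in\mathcal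 O$ be diagonal, and let $\mathcal U=\{\Lambda^{(lk)^{-1}} : k\in\mathcal C,\ l\in\mathrm L\}\subset\mathcal O$. Let $X\in\mathcal U$, $$X=(\Lambda+Y)^{k^{-1}}=(\Lambda+Z)^{u},\qquad Y,Z\in\mathfrak l,\ k\in\mathcal C,\ u\in\mathcal D.$$ Then the maximal trajectory $X(t)$ of the Toda vector field with $X(0)=X$ is defined for all $t\in\mathbb R$, and there are functions $l_{\Im},l_{\Re}:\mathbb R\to\mathrm L$ such that for all $t\in\mathbb R$ $$X(t)=\left((\Lambda+Y)^{\exp(-t\,i\,\Im\Lambda)}\right)^{\kappa(l_\Im(t))^{-1}}\qquad\text{and}\qquad X(t)=\left((\Lambda+Z)^{\exp(t\,\Re\Lambda)}\right)^{\nu(l_\Re(t))},$$ where $\Re\Lambda$ and $\Im\Lambda$ are the entrywise real and imaginary parts of $\Lambda$. In particular $X(t)\in\mathcal U$ for all $t\in\mathbb R$. -/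

import Mathlib

namespace TodaSL

open Matrix

/-- Square complex matrices of size `n`. -/
abbrev Mat (n : ℕ) : Type := Matrix (Fin n) (Fin n) ℂ

/-- The group `SL(n, ℂ)`. -/
abbrev SLC (n : ℕ) : Type := Matrix.SpecialLinearGroup (Fin n) ℂ

/-! ### Triangular matrices: auxiliary facts -/

theorem diag_mul_of_upper {n : ℕ} {A B : Mat n} (hA : ∀ i j, j < i → A i j = 0)
    (hB : ∀ i j, j < i → B i j = 0) (i : Fin n) : (A * B) i i = A i i * B i i := by
  rw [Matrix.mul_apply]
  refine Finset.sum_eq_single i (fun j _ hj => ?_) (by simp)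
  rcases lt_or_gt_of_ne hj with h | h
  · rw [hA i j h, zero_mul]
  · rw [hB j i h, mul_zero]

theorem upper_mul {n : ℕ} {A B : Mat n} (hA : ∀ i j, j < i → A i j = 0)
    (hB : ∀ i j, j < i → B i j = 0) : ∀ i j, j < i → (A * B) i j = 0 := by
  intro i j hij
  have h1 : A.BlockTriangular id := fun i j h => hA i j h
  have h2 : B.BlockTriangular id := fun i j h => hB i j h
  exact (h1.mul h2) hij

theorem coe_inv_eq {n : ℕ} (g : SLC n) : ((g⁻¹ : SLC n) : Mat n) = (g : Mat n)⁻¹ := by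
  symm
  apply Matrix.inv_eq_right_inv
  rw [← Matrix.SpecialLinearGroup.coe_mul, mul_inv_cancel, Matrix.SpecialLinearGroup.coe_one]

theorem upper_inv {n : ℕ} {g : SLC n} (hA : ∀ i j, j < i → (g : Mat n) i j = 0) :
    ∀ i j, j < i → ((g⁻¹ : SLC n) : Mat n) i j = 0 := by
  intro i j hij
  have h1 : (g : Mat n).BlockTriangular id := fun i j h => hA i j h
  rw [coe_inv_eq]
  have hdet : IsUnit (g : Mat n).det := by rw [g.det_coe]; exact isUnit_one
  have : Invertible (g : Mat n) := Matrix.invertibleOfIsUnitDet _ hdet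
  exact Matrix.blockTriangular_inv_of_blockTriangular h1 hij

theorem diag_inv_of_upper {n : ℕ} {g : SLC n} (hA : ∀ i j, j < i → (g : Mat n) i j = 0)
    (i : Fin n) : (g : Mat n) i i * ((g⁻¹ : SLC n) : Mat n) i i = 1 := by
  rw [← diag_mul_of_upper hA (upper_inv hA), ← Matrix.SpecialLinearGroup.coe_mul,
    mul_inv_cancel, Matrix.SpecialLinearGroup.coe_one, Matrix.one_apply_eq]

/-! ### The groups `K`, `U`, `L` -/

/-- `K`: the special unitary group. -/
def K (n : ℕ) : Subgroup (SLC n) where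
  carrier := {k | (k : Mat n) * (k : Mat n)ᴴ = 1}
  one_mem' := by simp
  mul_mem' := by
    intro a b ha hb
    simp only [Set.mem_ofPred_eq] at ha hb ⊢
    rw [Matrix.SpecialLinearGroup.coe_mul, Matrix.conjTranspose_mul, Matrix.mul_assoc,
      ← Matrix.mul_assoc (b : Mat n), hb, Matrix.one_mul, ha]
  inv_mem' := by
    intro a ha
    simp only [Set.mem_ofPred_eq] at ha ⊢
    rw [coe_inv_eq, Matrix.inv_eq_right_inv ha, Matrix.conjTranspose_conjTranspose]
    exact mul_eq_one_comm.mp ha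

/-- `U`: upper triangular matrices of determinant one with strictly positive diagonal entries. -/
def U (n : ℕ) : Subgroup (SLC n) where
  carrier := {u | (∀ i j, j < i → (u : Mat n) i j = 0) ∧
    ∀ i, 0 < ((u : Mat n) i i).re ∧ ((u : Mat n) i i).im = 0}
  one_mem' := by
    refine ⟨fun i j h => ?_, fun i => ?_⟩
    · simp [h.ne']
    · simp
  mul_mem' := by
    intro a b ha hb
    refine ⟨?_, fun i => ?_⟩
    · rw [Matrix.SpecialLinearGroup.coe_mul]
      exact upper_mul ha.1 hb.1
    · rw [Matrix.SpecialLinearGroup.coe_mul, diag_mul_of_upper ha.1 hb.1]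
      obtain ⟨p, q⟩ := ha.2 i
      obtain ⟨r, s⟩ := hb.2 i
      simp only [Complex.mul_re, Complex.mul_im, q, s]
      exact ⟨by simpa using mul_pos p r, by simp⟩
  inv_mem' := by
    intro a ha
    refine ⟨upper_inv ha.1, fun i => ?_⟩
    have h := diag_inv_of_upper ha.1 i
    obtain ⟨p, q⟩ := ha.2 i
    rw [eq_inv_of_mul_eq_one_right h, Complex.inv_re, Complex.inv_im, q]
    refine ⟨div_pos p ?_, by simp⟩
    exact Complex.normSq_pos.mpr (fun h0 => by simp [h0] at p)

/-- `L`: lower triangular matrices with all diagonal entries equal to one. -/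
def L (n : ℕ) : Subgroup (SLC n) where
  carrier := {l | (∀ i j, i < j → (l : Mat n) i j = 0) ∧ ∀ i, (l : Mat n) i i = 1}
  one_mem' := by
    refine ⟨fun i j h => ?_, fun i => ?_⟩
    · simp [h.ne]
    · simp
  mul_mem' := by
    intro a b ha hb
    have ht : ((a * b : SLC n) : Mat n) = ((b : Mat n)ᵀ * (a : Mat n)ᵀ)ᵀ := by simp
    have h1 : ∀ i j : Fin n, j < i → (a : Mat n)ᵀ i j = 0 := fun i j h => ha.1 j i h
    have h2 : ∀ i j : Fin n, j < i → (b : Mat n)ᵀ i j = 0 := fun i j h => hb.1 j i h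
    refine ⟨fun i j h => ?_, fun i => ?_⟩
    · rw [ht]
      exact upper_mul h2 h1 j i h
    · rw [ht, Matrix.transpose_apply, diag_mul_of_upper h2 h1]
      simp [ha.2, hb.2]
  inv_mem' := by
    intro a ha
    have h1 : ∀ i j : Fin n, j < i → (a.transpose : Mat n) i j = 0 :=
      fun i j h => ha.1 j i h
    have ht : ((a⁻¹ : SLC n) : Mat n) = (((a.transpose)⁻¹ : SLC n) : Mat n)ᵀ := by
      rw [coe_inv_eq, coe_inv_eq, Matrix.SpecialLinearGroup.coe_transpose,
        ← Matrix.transpose_nonsing_inv, Matrix.transpose_transpose]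
    refine ⟨fun i j h => ?_, fun i => ?_⟩
    · rw [ht]
      exact upper_inv h1 j i h
    · have h := diag_inv_of_upper h1 i
      rw [ht, Matrix.transpose_apply]
      rwa [show (a.transpose : Mat n) i i = 1 from ha.2 i, one_mul] at h

/-! ### The factorization `SL(n, ℂ) = K U` -/

theorem exists_QR {n : ℕ} (g : SLC n) : ∃ k u : SLC n, k ∈ K n ∧ u ∈ U n ∧ g = k * u := by
  let f : Fin n → EuclideanSpace ℂ (Fin n) := fun j => WithLp.toLp 2 (fun i => (g : Mat n) i j)
  have hdet : IsUnit (g : Mat n).det := by rw [g.det_coe]; exact isUnit_one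
  have hf : LinearIndependent ℂ f := by
    have h0 : LinearIndependent ℂ (g : Mat n).col :=
      Matrix.linearIndependent_cols_iff_isUnit.mpr ((Matrix.isUnit_iff_isUnit_det _).mpr hdet)
    exact h0.map' (WithLp.linearEquiv 2 ℂ (Fin n → ℂ)).symm.toLinearMap
      (LinearEquiv.ker _)
  have hcard : Module.finrank ℂ (EuclideanSpace ℂ (Fin n)) = Fintype.card (Fin n) := by simp
  let b := InnerProductSpace.gramSchmidtOrthonormalBasis hcard f
  let Q : Mat n := Matrix.of fun i j => b j i
  let R : Mat n := Matrix.of fun i j => inner ℂ (b i) (f j)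
  have hQR : (g : Mat n) = Q * R := by
    ext i j
    have h1 := congrArg (fun v : EuclideanSpace ℂ (Fin n) => v i) (b.sum_repr' (f j))
    simp only [WithLp.ofLp_sum, Finset.sum_apply, WithLp.ofLp_smul, Pi.smul_apply,
      smul_eq_mul] at h1
    rw [Matrix.mul_apply]
    simp only [Q, R, Matrix.of_apply]
    rw [show (g : Mat n) i j = (f j) i from rfl, ← h1]
    exact Finset.sum_congr rfl fun x _ => mul_comm _ _
  have hQ : Qᴴ * Q = 1 := by
    ext i j
    have h1 := orthonormal_iff_ite.mp b.orthonormal i j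
    rw [Matrix.mul_apply, Matrix.one_apply, ← h1, PiLp.inner_apply]
    refine Finset.sum_congr rfl fun x _ => ?_
    simp [Q, mul_comm]
  have hR : ∀ i j, j < i → R i j = 0 := fun i j h =>
    InnerProductSpace.gramSchmidtOrthonormalBasis_inv_triangular hcard f h
  have hd : ∀ i, 0 < (R i i).re ∧ (R i i).im = 0 := by
    intro i
    have hne : InnerProductSpace.gramSchmidtNormed ℂ f i ≠ 0 := by
      intro h0
      have := InnerProductSpace.gramSchmidtNormed_unit_length i hf
      rw [h0, norm_zero] at this
      exact zero_ne_one this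
    have hgs := InnerProductSpace.gramSchmidt_ne_zero i hf
    have hin : inner ℂ (InnerProductSpace.gramSchmidt ℂ f i) (f i) =
        ((‖InnerProductSpace.gramSchmidt ℂ f i‖ : ℂ)) ^ 2 := by
      conv_lhs => rw [InnerProductSpace.gramSchmidt_def'' ℂ f i]
      rw [inner_add_right, inner_sum, Finset.sum_eq_zero, add_zero, inner_self_eq_norm_sq_to_K]
      · rfl
      · intro x hx
        rw [inner_smul_right, InnerProductSpace.gramSchmidt_orthogonal ℂ f
          (Finset.mem_Iio.mp hx).ne', mul_zero]
    have hval : R i i = ((‖InnerProductSpace.gramSchmidt ℂ f i‖ : ℝ) : ℂ) := by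
      have hn : ((‖InnerProductSpace.gramSchmidt ℂ f i‖ : ℝ) : ℂ) ≠ 0 := by
        exact_mod_cast norm_ne_zero_iff.mpr hgs
      simp only [R, Matrix.of_apply, b]
      rw [InnerProductSpace.gramSchmidtOrthonormalBasis_apply hcard hne,
        InnerProductSpace.gramSchmidtNormed, inner_smul_left, hin]
      simp only [map_inv₀, RCLike.conj_ofReal]
      change (((‖InnerProductSpace.gramSchmidt ℂ f i‖ : ℝ) : ℂ))⁻¹ * _ = _
      field_simp
    rw [hval]
    exact ⟨by simpa using hgs, Complex.ofReal_im _⟩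
  have hdetR : ∃ r : ℝ, 0 < r ∧ R.det = r := by
    refine ⟨∏ i, (R i i).re, Finset.prod_pos fun i _ => (hd i).1, ?_⟩
    have hRt : R.BlockTriangular id := fun i j h => hR i j h
    rw [Matrix.det_of_isUpperTriangular hRt, Complex.ofReal_prod]
    refine Finset.prod_congr rfl fun i _ => ?_
    exact Complex.ext (by simp) (by simp [(hd i).2])
  obtain ⟨r, hr0, hr⟩ := hdetR
  have hdd : Q.det * R.det = 1 := by rw [← Matrix.det_mul, ← hQR, g.det_coe]
  have hnQ : ‖Q.det‖ = 1 := by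
    have h1 := congrArg Matrix.det hQ
    rw [Matrix.det_mul, Matrix.det_conjTranspose, Matrix.det_one] at h1
    have h2 := congrArg norm h1
    rw [norm_mul, norm_star, norm_one] at h2
    nlinarith [norm_nonneg Q.det]
  have hr1 : r = 1 := by
    have h2 := congrArg norm hdd
    rw [norm_mul, hnQ, one_mul, hr, Complex.norm_real, norm_one, Real.norm_of_nonneg hr0.le] at h2
    exact h2
  have hR1 : R.det = 1 := by rw [hr, hr1, Complex.ofReal_one]
  have hQ1 : Q.det = 1 := by rwa [hR1, mul_one] at hdd
  refine ⟨⟨Q, hQ1⟩, ⟨R, hR1⟩, ?_, ⟨hR, hd⟩, ?_⟩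
  · exact mul_eq_one_comm.mp hQ
  · exact Subtype.ext hQR

theorem eq_one_of_mem_K_of_mem_U {n : ℕ} {w : SLC n} (hK : w ∈ K n) (hU : w ∈ U n) : w = 1 := by
  have hK' : (w : Mat n) * (w : Mat n)ᴴ = 1 := hK
  have hinv : ((w⁻¹ : SLC n) : Mat n) = (w : Mat n)ᴴ := by
    rw [coe_inv_eq, Matrix.inv_eq_right_inv hK']
  apply Subtype.ext
  ext i j
  rw [Matrix.SpecialLinearGroup.coe_one]
  rcases lt_trichotomy i j with h | h | h
  · have h1 := upper_inv hU.1 j i h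
    rw [hinv, Matrix.conjTranspose_apply, star_eq_zero] at h1
    rw [Matrix.one_apply_ne h.ne]
    exact h1
  · subst h
    rw [Matrix.one_apply_eq]
    have h1 := diag_inv_of_upper hU.1 i
    rw [hinv, Matrix.conjTranspose_apply] at h1
    obtain ⟨p, q⟩ := hU.2 i
    have h2 := congrArg Complex.re h1
    simp [q] at h2
    refine Complex.ext ?_ (by simpa using q)
    rw [Complex.one_re]
    nlinarith
  · rw [Matrix.one_apply_ne h.ne']
    exact hU.1 i j h

/-- `κ : SL(n, ℂ) → K`: the first projection of the factorization `SL(n, ℂ) = K U`. -/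
noncomputable def kappa {n : ℕ} (g : SLC n) : SLC n := (exists_QR g).choose

/-- `ν : SL(n, ℂ) → U`: the second projection of the factorization `SL(n, ℂ) = K U`. -/
noncomputable def nu {n : ℕ} (g : SLC n) : SLC n := (exists_QR g).choose_spec.choose

theorem kappa_mem {n : ℕ} (g : SLC n) : kappa g ∈ K n := (exists_QR g).choose_spec.choose_spec.1

theorem nu_mem {n : ℕ} (g : SLC n) : nu g ∈ U n := (exists_QR g).choose_spec.choose_spec.2.1

theorem kappa_mul_nu {n : ℕ} (g : SLC n) : kappa g * nu g = g :=
  (exists_QR g).choose_spec.choose_spec.2.2.symm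

/-- The factorization is unique, so `κ` and `ν` are determined by it. -/
theorem kappa_nu_unique {n : ℕ} {g k u : SLC n} (hk : k ∈ K n) (hu : u ∈ U n) (h : g = k * u) :
    k = kappa g ∧ u = nu g := by
  have h1 : (kappa g)⁻¹ * k = nu g * u⁻¹ := by
    rw [inv_mul_eq_iff_eq_mul, ← mul_assoc, kappa_mul_nu, h, mul_inv_cancel_right]
  have h2 : (kappa g)⁻¹ * k = 1 := eq_one_of_mem_K_of_mem_U
    ((K n).mul_mem ((K n).inv_mem (kappa_mem g)) hk)
    (h1 ▸ (U n).mul_mem (nu_mem g) ((U n).inv_mem hu))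
  refine ⟨(inv_mul_eq_one.mp h2).symm, ?_⟩
  rw [h1] at h2
  exact (mul_inv_eq_one.mp h2).symm

/-- `𝒞`: the special unitary matrices that possess an `LU` factorization. -/
def bigC (n : ℕ) : Set (SLC n) := {k | k ∈ K n ∧ ∃ l ∈ L n, ∃ u ∈ U n, k = l * u}

/-- `𝒟 = ν(L)`: the elements `u` of `U` for which some `l = k u` with `l ∈ L`, `k ∈ K`. -/
def bigD (n : ℕ) : Set (SLC n) := {u | u ∈ U n ∧ ∃ l ∈ L n, ∃ k ∈ K n, l = k * u}

/-! ### Conjugation, conjugacy classes and the chart domain -/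

/-- `X ^ g = g X g⁻¹`, for an invertible matrix `g`. -/
noncomputable def conj {n : ℕ} (g X : Mat n) : Mat n := g * X * g⁻¹

/-- The conjugacy class of `X` under `SL(n, ℂ)`. -/
def conjClass {n : ℕ} (X : Mat n) : Set (Mat n) := {X' | ∃ g : SLC n, X' = conj g X}

/-- The `n` eigenvalues of `X` are pairwise distinct. -/
def HasSimpleSpectrum {n : ℕ} (X : Mat n) : Prop := X.charpoly.roots.Nodup

/-- `𝒪` is a conjugacy class in `𝔰𝔩(n, ℂ)` of matrices with simple spectrum. -/
def IsSimpleClass {n : ℕ} (O : Set (Mat n)) : Prop :=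
  ∃ X₀ ∈ LieAlgebra.SpecialLinear.sl (Fin n) ℂ, HasSimpleSpectrum X₀ ∧ O = conjClass X₀

/-- `𝒰`: the image of `𝒞 × L` under `(k, l) ↦ Λ ^ ((l k)⁻¹)`. -/
def chartDomain {n : ℕ} (Lam : Mat n) : Set (Mat n) :=
  {X | ∃ k ∈ bigC n, ∃ l ∈ L n, X = conj (((l * k)⁻¹ : SLC n) : Mat n) Lam}

/-- `𝔩`: the strictly lower triangular matrices. -/
def strictLower (n : ℕ) : Submodule ℂ (Mat n) where
  carrier := {Y | ∀ i j, i ≤ j → Y i j = 0}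
  zero_mem' := fun _ _ _ => rfl
  add_mem' := fun ha hb i j h => by rw [Matrix.add_apply, ha i j h, hb i j h, add_zero]
  smul_mem' := fun c a ha i j h => by rw [Matrix.smul_apply, ha i j h, smul_zero]

/-- The entrywise real part. -/
noncomputable def rePart {n : ℕ} (X : Mat n) : Mat n := X.map fun z => (z.re : ℂ)

/-- The entrywise imaginary part (a matrix with real entries). -/
noncomputable def imPart {n : ℕ} (X : Mat n) : Mat n := X.map fun z => (z.im : ℂ)

/-! ### The Toda vector field -/

/-- `𝔨`: the Lie algebra of `K`, traceless skew-Hermitian matrices. -/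
def kAlg (n : ℕ) : Set (Mat n) := {X | Xᴴ = -X ∧ X.trace = 0}

/-- `𝔲`: the Lie algebra of `U`, traceless upper triangular matrices with real diagonal. -/
def uAlg (n : ℕ) : Set (Mat n) :=
  {X | (∀ i j, j < i → X i j = 0) ∧ (∀ i, (X i i).im = 0) ∧ X.trace = 0}

/-- `π_𝔨`: the projection onto `𝔨` along `𝔲` in `𝔰𝔩(n, ℂ) = 𝔨 ⊕ 𝔲`
(see `piK_spec` and `piK_unique`). -/
noncomputable def piK {n : ℕ} (X : Mat n) : Mat n :=
  Matrix.of fun i j =>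
    if j < i then X i j else if i < j then -star (X j i) else Complex.I * ((X i i).im : ℂ)

theorem piK_spec {n : ℕ} {X : Mat n} (hX : X ∈ LieAlgebra.SpecialLinear.sl (Fin n) ℂ) :
    piK X ∈ kAlg n ∧ X - piK X ∈ uAlg n := by
  have htr : X.trace = 0 := hX
  have ht : (piK X).trace = 0 := by
    have h1 : (piK X).trace = Complex.I * ((X.trace.im : ℝ) : ℂ) := by
      simp [Matrix.trace, piK, Finset.mul_sum]
    rw [h1, htr]; simp
  refine ⟨⟨?_, ht⟩, ?_, ?_, ?_⟩
  · ext i j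
    rw [Matrix.conjTranspose_apply, Matrix.neg_apply]
    rcases lt_trichotomy i j with h | h | h
    · simp [piK, h, not_lt_of_gt h]
    · subst h; simp [piK]
    · simp [piK, h, not_lt_of_gt h]
  · intro i j h
    simp [piK, h]
  · intro i
    simp [piK]
  · rw [Matrix.trace_sub, htr, ht, sub_zero]

theorem piK_unique {n : ℕ} {X A B : Mat n} (hA : A ∈ kAlg n) (hB : B ∈ uAlg n)
    (h : X = A + B) : piK X = A := by
  have hA' : ∀ i j, star (A j i) = -A i j := fun i j => by
    rw [← Matrix.conjTranspose_apply, hA.1, Matrix.neg_apply]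
  ext i j
  subst h
  rcases lt_trichotomy i j with h | h | h
  · have h1 := hA' i j
    have h2 := hB.1 j i h
    simp only [piK, Matrix.of_apply, if_neg (not_lt_of_gt h), if_pos h, Matrix.add_apply, h2,
      add_zero, h1, neg_neg]
  · subst h
    have h1 := congrArg Complex.re (hA' i i)
    simp at h1
    have h3 : (A i i).re = 0 := by linarith
    refine Complex.ext ?_ ?_
    · simp [piK, h3]
    · simp [piK, hB.2.1 i]
  · simp [piK, h, hB.1 i j h]

/-- The Toda vector field `X ↦ [X, π_𝔨 X]`. -/
noncomputable def toda {n : ℕ} (X : Mat n) : Mat n := ⁅X, piK X⁆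

/-- On the set of times `J`, the curve `γ` solves `γ' = [γ, π_𝔨 γ]`, and `γ 0 = X`. -/
def IsTodaTrajectoryOn {n : ℕ} (J : Set ℝ) (X : Mat n) (γ : ℝ → Mat n) : Prop :=
  γ 0 = X ∧ ∀ t ∈ J, HasDerivAt γ (toda (γ t)) t

/-- `γ` is the maximal trajectory of the Toda vector field starting at `X`, and is defined for all
times: every trajectory on an open interval around `0` that starts at `X` is a restriction of it. -/
def IsTodaTrajectory {n : ℕ} (X : Mat n) (γ : ℝ → Mat n) : Prop :=
  IsTodaTrajectoryOn Set.univ X γ ∧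
    ∀ (J : Set ℝ) (δ : ℝ → Mat n), IsOpen J → J.OrdConnected → (0 : ℝ) ∈ J →
      IsTodaTrajectoryOn J X δ → Set.EqOn δ γ J

end TodaSL

/-!
The Toda equation is solved by factorization. Let `X` be conjugate to the diagonal matrix `Λ`, and
put `G(t) = exp(t X)`, an element of `SL(n, ℂ)`. If `G = K U` is its factorization, then
differentiating `K U` gives `K⁻¹ X K = K⁻¹ K' + U' U⁻¹`, so that `K⁻¹ K'` is the `𝔨`-part of
`γ = K⁻¹ X K`, and hence `γ' = [γ, π_𝔨 γ]` (`hasDerivAt_conj_kappa`). The differentiability of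
`κ` along a differentiable curve comes from the Gram–Schmidt recursion for the columns of `κ(g)`
(`kappa_apply`, `differentiableAt_kappa_apply`). The Toda field is `C¹`, so that `γ` is the unique
trajectory through `X` (`isTodaTrajectory_of_univ`).

The rest is algebra in `SL(n, ℂ)`. As `Λ` has simple spectrum, `Λ + Y = l⁻¹ Λ l` and
`Λ + Z = m⁻¹ Λ m` with `l, m ∈ L` (`exists_mem_L_conj`). Write `exp(t Λ) = W P` with
`W = exp(t i Im Λ) ∈ K` and `P = exp(t Re Λ) ∈ U`; both normalize `L`. With `k = l₁ u₁` and
`u = k₂⁻¹ l₂`, where `l₁, l₂ ∈ L`, `u₁ ∈ U` and `k₂ ∈ K`,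
  `G = (k⁻¹ W) lIm (P u₁)`, `lIm = (W⁻¹ l⁻¹ W) (P l l₁ P⁻¹) ∈ L`,
  `G = (k₂⁻¹ W) lRe (P u⁻¹)`, `lRe = (W⁻¹ l₂ m⁻¹ W) (P m P⁻¹) ∈ L`,
where the outer factors lie in `K` and in `U`. So `κ(G) = k⁻¹ W κ(lIm)` and
`ν(G) = ν(lRe) P u⁻¹`, and the two formulas follow from `γ = κ(G)⁻¹ X κ(G) = ν(G) X ν(G)⁻¹`.
Finally `γ = Λ ^ ((l' κ(lIm))⁻¹)` with `l' = W⁻¹ l W ∈ L`, and `κ(L) ⊆ 𝒞`, which puts `γ` in `𝒰`.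
-/

namespace TodaSL

open Matrix

/-! ### Uniqueness of trajectories -/

/-- A trajectory of a `C¹` autonomous vector field is determined, on an order-connected set of
times, by its position at one time. -/
theorem eqOn_of_hasDerivAt_of_contDiff {E : Type*} [NormedAddCommGroup E] [NormedSpace ℝ E]
    {v : E → E} (hv : ContDiff ℝ 1 v) {J : Set ℝ} (hJ : J.OrdConnected) {t₀ : ℝ} (ht₀ : t₀ ∈ J)
    {f g : ℝ → E} (hf : ∀ t ∈ J, HasDerivAt f (v (f t)) t)
    (hg : ∀ t ∈ J, HasDerivAt g (v (g t)) t) (heq : f t₀ = g t₀) : Set.EqOn f g J := by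
  intro t ht
  have hfc : ContinuousOn f J := HasDerivAt.continuousOn hf
  have hgc : ContinuousOn g J := HasDerivAt.continuousOn hg
  have hsub : Set.uIcc t₀ t ⊆ J := hJ.uIcc_subset ht₀ ht
  -- On the compact segment, both curves stay in a compact set, where the field is Lipschitz.
  obtain ⟨C, hC⟩ := LocallyLipschitzOn.exists_lipschitzOnWith_of_compact
    ((isCompact_uIcc.image_of_continuousOn (hfc.mono hsub)).union
      (isCompact_uIcc.image_of_continuousOn (hgc.mono hsub)))
    (hv.locallyLipschitz.locallyLipschitzOn (s := f '' Set.uIcc t₀ t ∪ g '' Set.uIcc t₀ t))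
  rcases le_total t₀ t with h | h
  · rw [Set.uIcc_of_le h] at hsub hC
    refine ODE_solution_unique_of_mem_Icc_right (v := fun _ => v)
      (s := fun _ => f '' Set.Icc t₀ t ∪ g '' Set.Icc t₀ t) (fun _ _ => hC)
      (hfc.mono hsub)
      (fun s hs => (hf s (hsub (Set.Ico_subset_Icc_self hs))).hasDerivWithinAt)
      (fun s hs => Or.inl ⟨s, Set.Ico_subset_Icc_self hs, rfl⟩)
      (hgc.mono hsub)
      (fun s hs => (hg s (hsub (Set.Ico_subset_Icc_self hs))).hasDerivWithinAt)
      (fun s hs => Or.inr ⟨s, Set.Ico_subset_Icc_self hs, rfl⟩) heq ⟨h, le_rfl⟩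
  · rw [Set.uIcc_of_ge h] at hsub hC
    refine ODE_solution_unique_of_mem_Icc_left (v := fun _ => v)
      (s := fun _ => f '' Set.Icc t t₀ ∪ g '' Set.Icc t t₀) (fun _ _ => hC)
      (hfc.mono hsub)
      (fun s hs => (hf s (hsub (Set.Ioc_subset_Icc_self hs))).hasDerivWithinAt)
      (fun s hs => Or.inl ⟨s, Set.Ioc_subset_Icc_self hs, rfl⟩)
      (hgc.mono hsub)
      (fun s hs => (hg s (hsub (Set.Ioc_subset_Icc_self hs))).hasDerivWithinAt)
      (fun s hs => Or.inr ⟨s, Set.Ioc_subset_Icc_self hs, rfl⟩) heq ⟨le_rfl, h⟩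

/-! ### Calculus of matrix-valued curves -/

theorem hasDerivAt_matrix {n : ℕ} {A : ℝ → Mat n} {A' : Mat n} {t : ℝ} :
    HasDerivAt A A' t ↔ ∀ i j, HasDerivAt (fun s => A s i j) (A' i j) t :=
  (hasDerivAt_pi (φ := A) (φ' := A')).trans (forall_congr' fun _ => hasDerivAt_pi)

theorem hasDerivAt_mul {n : ℕ} {A B : ℝ → Mat n} {A' B' : Mat n} {t : ℝ}
    (hA : HasDerivAt A A' t) (hB : HasDerivAt B B' t) :
    HasDerivAt (fun s => A s * B s) (A' * B t + A t * B') t :=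
  letI : NormedRing (Mat n) := Matrix.linftyOpNormedRing
  letI : NormedAlgebra ℝ (Mat n) := Matrix.linftyOpNormedAlgebra
  HasDerivAt.mul hA hB

theorem hasDerivAt_const_matrix {n : ℕ} (A : Mat n) (t : ℝ) :
    HasDerivAt (fun _ => A) (0 : Mat n) t :=
  hasDerivAt_matrix.mpr fun i j => hasDerivAt_const t (A i j)

theorem hasDerivAt_conjTranspose {n : ℕ} {A : ℝ → Mat n} {A' : Mat n} {t : ℝ}
    (hA : HasDerivAt A A' t) : HasDerivAt (fun s => (A s)ᴴ) A'ᴴ t :=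
  hasDerivAt_matrix.mpr fun i j => (hasDerivAt_matrix.mp hA j i).star

section

-- `ContDiff` needs a norm; which one is immaterial in finite dimension.
attribute [local instance] Matrix.linftyOpNormedRing Matrix.linftyOpNormedAlgebra

theorem contDiff_piK (n : ℕ) : ContDiff ℝ 1 (piK : Mat n → Mat n) := by
  let T : Mat n →ₗ[ℝ] Mat n :=
    { toFun := piK
      map_add' := fun A B => by
        ext i j
        simp only [piK, of_apply, Matrix.add_apply]
        split_ifs <;> simp <;> try ring
      map_smul' := fun c A => by
        ext i j
        simp only [piK, of_apply, Matrix.smul_apply, RingHom.id_apply]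
        split_ifs <;> simp
        ring }
  exact (LinearMap.toContinuousLinearMap T).contDiff

theorem contDiff_toda (n : ℕ) : ContDiff ℝ 1 (toda : Mat n → Mat n) := by
  have h := contDiff_piK n
  exact (contDiff_id.mul h).sub (h.mul contDiff_id)

theorem isTodaTrajectory_of_univ {n : ℕ} {X : Mat n} {γ : ℝ → Mat n}
    (h : IsTodaTrajectoryOn Set.univ X γ) : IsTodaTrajectory X γ :=
  ⟨h, fun _ _ _ hJ h0 hδ => eqOn_of_hasDerivAt_of_contDiff (contDiff_toda n) hJ h0 hδ.2
    (fun t _ => h.2 t (Set.mem_univ t)) (hδ.1.trans h.1.symm)⟩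

end

/-! ### Differentiability of the factorization `SL(n, ℂ) = K U` -/

theorem conjTranspose_mul_of_mem_K {n : ℕ} {k : SLC n} (hk : k ∈ K n) :
    (k : Mat n)ᴴ * (k : Mat n) = 1 :=
  mul_eq_one_comm.mp hk

theorem coe_inv_of_mem_K {n : ℕ} {k : SLC n} (hk : k ∈ K n) :
    ((k⁻¹ : SLC n) : Mat n) = (k : Mat n)ᴴ := by
  rw [coe_inv_eq]
  exact Matrix.inv_eq_right_inv hk

theorem coe_nu_eq {n : ℕ} (g : SLC n) : (nu g : Mat n) = (kappa g : Mat n)ᴴ * (g : Mat n) := by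
  rw [← coe_inv_of_mem_K (kappa_mem g), ← Matrix.SpecialLinearGroup.coe_mul]
  exact congrArg _ (eq_inv_mul_of_mul_eq (kappa_mul_nu g))

/-- Column `j` of `g`, made orthogonal to the preceding columns of `κ(g)`. -/
noncomputable def residual {n : ℕ} (g : SLC n) (j a : Fin n) : ℂ :=
  (g : Mat n) a j - ∑ i ∈ Finset.Iio j,
    (kappa g : Mat n) a i * ∑ b, star ((kappa g : Mat n) b i) * (g : Mat n) b j

theorem residual_eq {n : ℕ} (g : SLC n) (j a : Fin n) :
    residual g j a = (kappa g : Mat n) a j * (((nu g : Mat n) j j).re : ℂ) := by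
  have h1 : (g : Mat n) a j = ∑ i, (kappa g : Mat n) a i * (nu g : Mat n) i j := by
    rw [← Matrix.mul_apply, ← Matrix.SpecialLinearGroup.coe_mul, kappa_mul_nu]
  have h2 : ∀ i, ∑ b, star ((kappa g : Mat n) b i) * (g : Mat n) b j = (nu g : Mat n) i j := by
    intro i
    rw [coe_nu_eq, Matrix.mul_apply]
    rfl
  have h3 : (((nu g : Mat n) j j).re : ℂ) = (nu g : Mat n) j j :=
    Complex.ext (by simp) (by simp [((nu_mem g).2 j).2])
  have h4 : ∑ i, (kappa g : Mat n) a i * (nu g : Mat n) i j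
      = ∑ i ∈ Finset.Iic j, (kappa g : Mat n) a i * (nu g : Mat n) i j := by
    refine (Finset.sum_subset (Finset.subset_univ _) fun i _ hi => ?_).symm
    rw [(nu_mem g).1 i j (not_le.mp (by simpa using hi)), mul_zero]
  simp only [residual, h2]
  rw [h1, h4, h3, ← Finset.Iio_insert, Finset.sum_insert (by simp), add_sub_cancel_right]

theorem sum_normSq_residual {n : ℕ} (g : SLC n) (j : Fin n) :
    ∑ a, Complex.normSq (residual g j a) = ((nu g : Mat n) j j).re ^ 2 := by
  have h := congrFun (congrFun (conjTranspose_mul_of_mem_K (kappa_mem g)) j) j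
  rw [Matrix.mul_apply, Matrix.one_apply_eq] at h
  have h1 : ∑ a, Complex.normSq ((kappa g : Mat n) a j) = 1 := by
    apply Complex.ofReal_injective
    rw [Complex.ofReal_sum, Complex.ofReal_one]
    refine Eq.trans ?_ h
    exact Finset.sum_congr rfl fun a _ => Complex.normSq_eq_conj_mul_self
  simp only [residual_eq, map_mul, Complex.normSq_ofReal]
  rw [← Finset.sum_mul, h1, one_mul, sq]

/-- The Gram–Schmidt recursion: a column of `κ(g)` is a normalized residual. -/
theorem kappa_apply {n : ℕ} (g : SLC n) (a j : Fin n) :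
    (kappa g : Mat n) a j =
      residual g j a * ((√(∑ b, Complex.normSq (residual g j b)))⁻¹ : ℝ) := by
  have hpos := ((nu_mem g).2 j).1
  rw [sum_normSq_residual, Real.sqrt_sq hpos.le, residual_eq, mul_assoc, ← Complex.ofReal_mul,
    mul_inv_cancel₀ hpos.ne', Complex.ofReal_one, mul_one]

theorem differentiableAt_kappa_apply {n : ℕ} {F : ℝ → SLC n} {t : ℝ}
    (hF : ∀ i j, DifferentiableAt ℝ (fun s => (F s : Mat n) i j) t) (j a : Fin n) :
    DifferentiableAt ℝ (fun s => (kappa (F s) : Mat n) a j) t := by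
  induction j using WellFoundedLT.induction generalizing a with
  | ind j ih =>
    have hres : ∀ b, DifferentiableAt ℝ (fun s => residual (F s) j b) t := fun b =>
      (hF b j).sub (DifferentiableAt.fun_sum fun i hi =>
        (ih i (Finset.mem_Iio.mp hi) b).mul (DifferentiableAt.fun_sum fun c _ =>
          ((ih i (Finset.mem_Iio.mp hi) c).star).mul (hF c j)))
    have hns : DifferentiableAt ℝ (fun s => ∑ b, Complex.normSq (residual (F s) j b)) t := by
      refine DifferentiableAt.fun_sum fun b _ => ?_
      simp only [Complex.normSq_eq_norm_sq]
      exact (hres b).norm_sq ℝ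
    have hpos : 0 < ((nu (F t) : Mat n) j j).re := ((nu_mem (F t)).2 j).1
    have hne : ∑ b, Complex.normSq (residual (F t) j b) ≠ 0 := by
      rw [sum_normSq_residual]
      positivity
    have hsq : √(∑ b, Complex.normSq (residual (F t) j b)) ≠ 0 := by
      rw [sum_normSq_residual, Real.sqrt_sq hpos.le]
      exact hpos.ne'
    simp only [kappa_apply (F _) a j]
    exact (hres a).mul (Complex.ofRealCLM.differentiableAt.comp t ((hns.sqrt hne).inv hsq))

/-! ### The factorization method -/

/-- `piK_unique` without the trace conditions. -/
theorem piK_eq_of_add {n : ℕ} {A B : Mat n} (hA : Aᴴ = -A) (hB : ∀ i j, j < i → B i j = 0)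
    (hd : ∀ i, (B i i).im = 0) : piK (A + B) = A := by
  have hA' : ∀ i j, star (A j i) = -A i j := fun i j => by
    rw [← Matrix.conjTranspose_apply, hA, Matrix.neg_apply]
  ext i j
  rcases lt_trichotomy i j with h | h | h
  · simpa [piK, not_lt_of_gt h, h, hB j i h, neg_eq_iff_eq_neg] using hA' i j
  · subst h
    have h1 := congrArg Complex.re (hA' i i)
    simp only [Complex.star_def, Complex.conj_re, Complex.neg_re] at h1
    have h3 : (A i i).re = 0 := by linarith
    refine Complex.ext ?_ ?_
    · simp [piK, h3]
    · simp [piK, hd i]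
  · simp [piK, h, hB i j h]

/-- If `F' = X F`, then `t ↦ κ(F(t))⁻¹ X κ(F(t))` solves the Toda equation. Writing `F = K U`, one
has `K⁻¹ X K = K⁻¹ K' + U' U⁻¹`, and this is the decomposition into `𝔨` and `𝔲`. -/
theorem hasDerivAt_conj_kappa {n : ℕ} {X : Mat n} {F : ℝ → SLC n} {t : ℝ}
    (hF : HasDerivAt (fun s => (F s : Mat n)) (X * (F t : Mat n)) t) :
    HasDerivAt (fun s => conj (((kappa (F s))⁻¹ : SLC n) : Mat n) X)
      (toda (conj (((kappa (F t))⁻¹ : SLC n) : Mat n) X)) t := by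
  have hconj : ∀ s, conj (((kappa (F s))⁻¹ : SLC n) : Mat n) X
      = (kappa (F s) : Mat n)ᴴ * X * (kappa (F s) : Mat n) := by
    intro s
    rw [conj, ← coe_inv_eq, inv_inv, coe_inv_of_mem_K (kappa_mem _)]
  simp only [hconj]
  obtain ⟨k', hk'⟩ : ∃ k' : Mat n, HasDerivAt (fun s => (kappa (F s) : Mat n)) k' t := by
    refine ⟨of fun i j => deriv (fun s => (kappa (F s) : Mat n) i j) t,
      hasDerivAt_matrix.mpr fun i j => ?_⟩
    exact (differentiableAt_kappa_apply
      (fun i j => (hasDerivAt_matrix.mp hF i j).differentiableAt) j i).hasDerivAt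
  have hks := hasDerivAt_conjTranspose hk'
  have hu' := hasDerivAt_mul hks hF
  have hk1 := conjTranspose_mul_of_mem_K (kappa_mem (F t))
  have hk2 : (kappa (F t) : Mat n) * (kappa (F t) : Mat n)ᴴ = 1 := kappa_mem (F t)
  have hFk : (F t : Mat n) * ((nu (F t))⁻¹ : SLC n) = kappa (F t) := by
    rw [← Matrix.SpecialLinearGroup.coe_mul]
    congr 1
    exact mul_inv_eq_of_eq_mul (kappa_mul_nu _).symm
  set k : Mat n := (kappa (F t) : Mat n) with hk
  set u' : Mat n := k'ᴴ * (F t : Mat n) + kᴴ * (X * (F t : Mat n)) with hu'def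
  -- differentiate `kᴴ k = 1`
  have hskew : k'ᴴ * k + kᴴ * k' = 0 := by
    have h1 := hasDerivAt_mul hks hk'
    have h2 : (fun s => (kappa (F s) : Mat n)ᴴ * (kappa (F s) : Mat n)) = fun _ => 1 :=
      funext fun s => conjTranspose_mul_of_mem_K (kappa_mem (F s))
    rw [h2] at h1
    ext i j
    exact (hasDerivAt_matrix.mp h1 i j).unique
      (hasDerivAt_matrix.mp (hasDerivAt_const_matrix (1 : Mat n) t) i j)
  have hneg : k'ᴴ * k = -(kᴴ * k') := eq_neg_of_add_eq_zero_left hskew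
  have hA : (kᴴ * k')ᴴ = -(kᴴ * k') := by
    rw [conjTranspose_mul, conjTranspose_conjTranspose, hneg]
  -- differentiate the conditions that define `U`, along `ν ∘ F`
  have hnu : ∀ i j, HasDerivAt (fun s => (nu (F s) : Mat n) i j) (u' i j) t := by
    intro i j
    simp only [coe_nu_eq]
    exact hasDerivAt_matrix.mp hu' i j
  have hup : ∀ i j, j < i → u' i j = 0 := by
    intro i j hij
    have h1 := hnu i j
    simp only [(nu_mem (F _)).1 i j hij] at h1
    exact h1.unique (hasDerivAt_const t 0)
  have hdi : ∀ i, (u' i i).im = 0 := by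
    intro i
    have h1 : HasDerivAt (fun s => ((nu (F s) : Mat n) i i).im) (u' i i).im t :=
      Complex.imCLM.hasFDerivAt.comp_hasDerivAt t (hnu i i)
    simp only [((nu_mem (F _)).2 i).2] at h1
    exact h1.unique (hasDerivAt_const t 0)
  have hinv := (U n).inv_mem (nu_mem (F t))
  set B : Mat n := u' * ((nu (F t))⁻¹ : SLC n) with hB
  have hXB : kᴴ * X * k = kᴴ * k' + B := by
    rw [hB, hu'def, Matrix.add_mul, Matrix.mul_assoc k'ᴴ, hFk, hneg, Matrix.mul_assoc kᴴ (X * _),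
      Matrix.mul_assoc X, hFk, ← Matrix.mul_assoc]
    abel
  have hpi : piK (kᴴ * X * k) = kᴴ * k' := by
    rw [hXB]
    refine piK_eq_of_add hA (upper_mul hup hinv.1) fun i => ?_
    rw [hB, diag_mul_of_upper hup hinv.1, Complex.mul_im, hdi i, (hinv.2 i).2]
    ring
  have key := hasDerivAt_mul (hasDerivAt_mul hks (hasDerivAt_const_matrix X t)) hk'
  convert! key using 1
  rw [toda, hpi, Ring.lie_def]
  have h5 : k'ᴴ = -(kᴴ * k' * kᴴ) := by
    rw [← Matrix.neg_mul, ← hneg, Matrix.mul_assoc, hk2, Matrix.mul_one]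
  have h6 : kᴴ * X * k * (kᴴ * k') = kᴴ * X * k' := by
    rw [← Matrix.mul_assoc, Matrix.mul_assoc (kᴴ * X), hk2, Matrix.mul_one]
  rw [h6, Matrix.mul_zero, add_zero, h5]
  simp only [Matrix.neg_mul, Matrix.mul_assoc]
  abel

/-! ### Conjugation by elements of `SL(n, ℂ)` -/

theorem conj_coe {n : ℕ} (g : SLC n) (X : Mat n) :
    conj (g : Mat n) X = (g : Mat n) * X * ((g⁻¹ : SLC n) : Mat n) := by
  rw [conj, coe_inv_eq]

theorem conj_coe_mul {n : ℕ} (g h : SLC n) (X : Mat n) :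
    conj ((g * h : SLC n) : Mat n) X = conj (g : Mat n) (conj (h : Mat n) X) := by
  rw [conj_coe, conj_coe, conj_coe, _root_.mul_inv_rev, Matrix.SpecialLinearGroup.coe_mul,
    Matrix.SpecialLinearGroup.coe_mul]
  simp only [Matrix.mul_assoc]

theorem coe_inv_mul_coe {n : ℕ} (g : SLC n) : ((g⁻¹ : SLC n) : Mat n) * (g : Mat n) = 1 := by
  rw [← Matrix.SpecialLinearGroup.coe_mul, inv_mul_cancel, Matrix.SpecialLinearGroup.coe_one]

theorem conj_coe_one {n : ℕ} (X : Mat n) : conj ((1 : SLC n) : Mat n) X = X := by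
  simp [conj]

theorem conj_eq_iff {n : ℕ} {g : SLC n} {X A : Mat n} :
    conj (g : Mat n) A = X ↔ A = conj ((g⁻¹ : SLC n) : Mat n) X := by
  constructor
  · rintro rfl
    rw [← conj_coe_mul, inv_mul_cancel, conj_coe_one]
  · rintro rfl
    rw [← conj_coe_mul, mul_inv_cancel, conj_coe_one]

theorem conj_eq_iff_mul_eq {n : ℕ} {g : SLC n} {X A : Mat n} :
    conj (g : Mat n) A = X ↔ (g : Mat n) * A = X * (g : Mat n) := by
  rw [conj_coe]
  constructor
  · rintro rfl
    rw [Matrix.mul_assoc, coe_inv_mul_coe, Matrix.mul_one]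
  · intro h
    have h1 := coe_inv_mul_coe g⁻¹
    rw [inv_inv] at h1
    rw [h, Matrix.mul_assoc, h1, Matrix.mul_one]

/-! ### The projections `κ` and `ν` -/

theorem kappa_nu_mul_mul {n : ℕ} {a b : SLC n} (ha : a ∈ K n) (hb : b ∈ U n) (g : SLC n) :
    kappa (a * g * b) = a * kappa g ∧ nu (a * g * b) = nu g * b := by
  obtain ⟨h1, h2⟩ := kappa_nu_unique ((K n).mul_mem ha (kappa_mem g))
    ((U n).mul_mem (nu_mem g) hb)
    (show a * g * b = a * kappa g * (nu g * b) by
      rw [mul_assoc a (kappa g), ← mul_assoc (kappa g), kappa_mul_nu, mul_assoc a])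
  exact ⟨h1.symm, h2.symm⟩

theorem kappa_mem_bigC {n : ℕ} {l : SLC n} (hl : l ∈ L n) : kappa l ∈ bigC n :=
  ⟨kappa_mem l, l, hl, (nu l)⁻¹, (U n).inv_mem (nu_mem l),
    eq_mul_inv_of_mul_eq (kappa_mul_nu l)⟩

/-! ### Exponentials of diagonal matrices -/

/-- The exponential of a traceless diagonal matrix, as an element of `SL(n, ℂ)`. -/
noncomputable def expDiag {n : ℕ} (d : Fin n → ℂ) (hd : ∑ i, d i = 0) : SLC n :=
  ⟨diagonal fun i => Complex.exp (d i), by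
    rw [det_diagonal, ← Complex.exp_sum, hd, Complex.exp_zero]⟩

theorem coe_expDiag {n : ℕ} (d : Fin n → ℂ) (hd : ∑ i, d i = 0) :
    (expDiag d hd : Mat n) = diagonal fun i => Complex.exp (d i) := rfl

theorem expDiag_mul {n : ℕ} {d e : Fin n → ℂ} (hd : ∑ i, d i = 0) (he : ∑ i, e i = 0) :
    expDiag d hd * expDiag e he =
      expDiag (d + e) (by simp [Finset.sum_add_distrib, hd, he]) := by
  apply Subtype.ext
  rw [Matrix.SpecialLinearGroup.coe_mul]
  simp only [coe_expDiag, diagonal_mul_diagonal, Pi.add_apply, Complex.exp_add]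

theorem expDiag_inv {n : ℕ} {d : Fin n → ℂ} (hd : ∑ i, d i = 0) :
    (expDiag d hd)⁻¹ = expDiag (-d) (by simp [hd]) := by
  rw [inv_eq_iff_mul_eq_one, expDiag_mul]
  apply Subtype.ext
  simp [coe_expDiag]

theorem expDiag_mem_U {n : ℕ} {d : Fin n → ℂ} (hd : ∑ i, d i = 0) (him : ∀ i, (d i).im = 0) :
    expDiag d hd ∈ U n := by
  refine ⟨fun i j h => diagonal_apply_ne _ h.ne', fun i => ?_⟩
  rw [coe_expDiag, diagonal_apply_eq, Complex.exp_re, Complex.exp_im, him i]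
  simp [Real.exp_pos]

theorem expDiag_mem_K {n : ℕ} {d : Fin n → ℂ} (hd : ∑ i, d i = 0) (hre : ∀ i, (d i).re = 0) :
    expDiag d hd ∈ K n := by
  change (expDiag d hd : Mat n) * (expDiag d hd : Mat n)ᴴ = 1
  rw [coe_expDiag, diagonal_conjTranspose, diagonal_mul_diagonal, ← diagonal_one]
  congr 1
  funext i
  rw [Pi.star_apply, Complex.star_def, ← Complex.exp_conj, ← Complex.exp_add,
    show d i + (starRingEnd ℂ) (d i) = 0 from Complex.ext (by simp [hre i]) (by simp),
    Complex.exp_zero]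

theorem expDiag_mul_mul_inv_mem_L {n : ℕ} {d : Fin n → ℂ} (hd : ∑ i, d i = 0) {l : SLC n}
    (hl : l ∈ L n) : expDiag d hd * l * (expDiag d hd)⁻¹ ∈ L n := by
  have h : ∀ i j, ((expDiag d hd * l * (expDiag d hd)⁻¹ : SLC n) : Mat n) i j
      = Complex.exp (d i) * (l : Mat n) i j * Complex.exp (-d j) := by
    intro i j
    rw [expDiag_inv, Matrix.SpecialLinearGroup.coe_mul, Matrix.SpecialLinearGroup.coe_mul,
      coe_expDiag, coe_expDiag, mul_diagonal, diagonal_mul, Pi.neg_apply]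
  refine ⟨fun i j hij => ?_, fun i => ?_⟩
  · rw [h, hl.1 i j hij, mul_zero, zero_mul]
  · rw [h, hl.2 i, mul_one, ← Complex.exp_add, add_neg_cancel, Complex.exp_zero]

theorem inv_expDiag_mul_mul_mem_L {n : ℕ} {d : Fin n → ℂ} (hd : ∑ i, d i = 0) {l : SLC n}
    (hl : l ∈ L n) : (expDiag d hd)⁻¹ * l * expDiag d hd ∈ L n := by
  have h := expDiag_mul_mul_inv_mem_L (d := -d) (by simp [hd]) hl
  rwa [← expDiag_inv hd, inv_inv] at h

theorem exp_diagonal_eq {n : ℕ} (d : Fin n → ℂ) :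
    NormedSpace.exp (diagonal d : Mat n) = diagonal fun i => Complex.exp (d i) := by
  rw [Matrix.exp_diagonal]
  congr 1
  funext i
  rw [Pi.coe_exp, Complex.exp_eq_exp_ℂ]

/-- A matrix that commutes with a diagonal matrix commutes with its exponentials. -/
theorem mul_diagonal_exp_comm {n : ℕ} {A : Mat n} {d : Fin n → ℂ}
    (h : A * diagonal d = diagonal d * A) (t : ℂ) :
    A * (diagonal fun i => Complex.exp (t * d i)) =
      (diagonal fun i => Complex.exp (t * d i)) * A := by
  ext i j
  have h1 := congrFun (congrFun h i) j
  rw [mul_diagonal, diagonal_mul] at h1 ⊢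
  by_cases hA : A i j = 0
  · simp [hA]
  · rw [mul_comm, mul_right_cancel₀ hA ((mul_comm _ _).trans h1)]

theorem hasDerivAt_expDiag {n : ℕ} (d : Fin n → ℂ) (t : ℝ) :
    HasDerivAt (fun s : ℝ => (diagonal fun i => Complex.exp ((s : ℂ) * d i) : Mat n))
      (diagonal d * diagonal fun i => Complex.exp ((t : ℂ) * d i)) t := by
  refine hasDerivAt_matrix.mpr fun i j => ?_
  rw [diagonal_mul_diagonal]
  rcases eq_or_ne i j with rfl | hij
  · simp only [diagonal_apply_eq]
    have h : HasDerivAt (fun s : ℝ => (s : ℂ) * d i) (d i) t := by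
      simpa using (Complex.ofRealCLM.hasDerivAt (x := t)).mul_const (d i)
    simpa [mul_comm] using h.cexp
  · simp only [diagonal_apply_ne _ hij]
    exact hasDerivAt_const t 0

/-! ### Simple spectrum -/

theorem charpoly_conj {n : ℕ} (g : SLC n) (X : Mat n) :
    (conj (g : Mat n) X).charpoly = X.charpoly := by
  rw [conj_coe, Matrix.charpoly_mul_comm, ← Matrix.mul_assoc, coe_inv_mul_coe, Matrix.one_mul]

theorem trace_conj {n : ℕ} (g : SLC n) (X : Mat n) :
    (conj (g : Mat n) X).trace = X.trace := by
  rw [conj_coe, Matrix.trace_mul_comm, ← Matrix.mul_assoc, coe_inv_mul_coe, Matrix.one_mul]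

theorem injective_of_hasSimpleSpectrum {n : ℕ} {d : Fin n → ℂ}
    (h : HasSimpleSpectrum (diagonal d : Mat n)) : Function.Injective d := by
  have h1 : (diagonal d : Mat n).charpoly.roots = Finset.univ.val.map d := by
    rw [charpoly_diagonal, Polynomial.roots_prod _ _
      (Finset.prod_ne_zero_iff.mpr fun i _ => Polynomial.X_sub_C_ne_zero (d i))]
    simp only [Polynomial.roots_X_sub_C, Multiset.bind_singleton]
  rw [HasSimpleSpectrum, h1] at h
  exact fun i j hij => Multiset.inj_on_of_nodup_map h i (Finset.mem_univ i) j
    (Finset.mem_univ j) hij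

/-- If `Λ` is diagonal with simple spectrum and `Λ + Y`, with `Y` strictly lower triangular, is a
conjugate of `Λ`, then it is a conjugate of `Λ` under `L`. Indeed the first nonzero coordinate of
an eigenvector of `Λ + Y` for the eigenvalue `Λⱼⱼ` has index `j`, so that a matrix of eigenvectors
is lower triangular, and its columns can be rescaled. -/
theorem exists_mem_L_conj {n : ℕ} {d : Fin n → ℂ} (hd : Function.Injective d) {Y : Mat n}
    (hY : Y ∈ strictLower n) {g : SLC n}
    (h : diagonal d + Y = conj (g : Mat n) (diagonal d)) :
    ∃ l ∈ L n, diagonal d + Y = conj ((l⁻¹ : SLC n) : Mat n) (diagonal d) := by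
  have hg := conj_eq_iff_mul_eq.mp h.symm
  have hlow : ∀ i j, i < j → (g : Mat n) i j = 0 := by
    intro i j hij
    induction i using WellFoundedLT.induction with
    | ind i ih =>
      have h1 := congrFun (congrFun hg i) j
      rw [mul_diagonal, Matrix.add_mul, Matrix.add_apply, diagonal_mul, Matrix.mul_apply,
        Finset.sum_eq_zero, add_zero] at h1
      · by_contra h0
        have h2 : d j = d i := mul_left_cancel₀ h0 (h1.trans (mul_comm _ _))
        exact hij.ne (hd h2).symm
      · intro a _
        rcases lt_or_ge a i with ha | ha
        · rw [ih a ha (ha.trans hij), mul_zero]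
        · rw [hY i a ha, zero_mul]
  have hdet : ∏ i, (g : Mat n) i i = 1 := by
    exact (Matrix.det_of_isLowerTriangular _ fun i j hij => hlow i j hij).symm.trans g.det_coe
  have hne : ∀ i, (g : Mat n) i i ≠ 0 := fun i =>
    Finset.prod_ne_zero_iff.mp (hdet.trans_ne one_ne_zero) i (Finset.mem_univ i)
  let c : SLC n := ⟨diagonal fun i => ((g : Mat n) i i)⁻¹, by
    rw [det_diagonal, Finset.prod_inv_distrib, hdet, inv_one]⟩
  have hc : (c : Mat n) = diagonal fun i => ((g : Mat n) i i)⁻¹ := rfl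
  have hgc : g * c ∈ L n := by
    have h1 : ∀ i j, ((g * c : SLC n) : Mat n) i j = (g : Mat n) i j * ((g : Mat n) j j)⁻¹ := by
      intro i j
      rw [Matrix.SpecialLinearGroup.coe_mul, hc, mul_diagonal]
    exact ⟨fun i j hij => by rw [h1, hlow i j hij, zero_mul],
      fun i => by rw [h1, mul_inv_cancel₀ (hne i)]⟩
  refine ⟨(g * c)⁻¹, (L n).inv_mem hgc, ?_⟩
  have hcd : conj (c : Mat n) (diagonal d) = diagonal d := by
    rw [conj_eq_iff_mul_eq, hc, diagonal_mul_diagonal, diagonal_mul_diagonal]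
    simp only [mul_comm]
  rw [inv_inv, conj_coe_mul, hcd, h]

/-! ### Trajectories through the chart domain -/

/-- If `X = Λ ^ p` with `Λ` diagonal, then conjugating `X` by `κ(exp(t X))⁻¹`, where
`exp(t X) = exp(t Λ) ^ p`, gives the trajectory of the Toda vector field through `X`. -/
theorem isTodaTrajectory_conj_kappa {n : ℕ} {d : Fin n → ℂ} {X : Mat n} {p : SLC n}
    (hX : X = conj (p : Mat n) (diagonal d)) {E : ℝ → SLC n}
    (hE : ∀ t, (E t : Mat n) = diagonal fun i => Complex.exp ((t : ℂ) * d i)) :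
    IsTodaTrajectory X
      fun t => conj (((kappa (p * E t * p⁻¹))⁻¹ : SLC n) : Mat n) X := by
  refine isTodaTrajectory_of_univ ⟨?_, fun t _ => hasDerivAt_conj_kappa ?_⟩
  · have h0 : E 0 = 1 := Subtype.ext (by simpa using hE 0)
    have h1 : (1 : SLC n) = kappa 1 :=
      (kappa_nu_unique (K n).one_mem (U n).one_mem (mul_one 1).symm).1
    simp only [h0, mul_one, mul_inv_cancel]
    rw [← h1, inv_one, conj_coe_one]
  · simp only [Matrix.SpecialLinearGroup.coe_mul, hE]
    have h2 := hasDerivAt_mul (hasDerivAt_mul (hasDerivAt_const_matrix (p : Mat n) t)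
      (hasDerivAt_expDiag d t)) (hasDerivAt_const_matrix ((p⁻¹ : SLC n) : Mat n) t)
    convert! h2 using 1
    rw [hX, conj_coe, Matrix.mul_zero, add_zero, Matrix.zero_mul, zero_add]
    simp only [Matrix.mul_assoc]
    rw [← Matrix.mul_assoc _ (p : Mat n), coe_inv_mul_coe, Matrix.one_mul]

/-- `exp(t X) = exp(t Λ) ^ p` does not depend on the choice of `p` with `X = Λ ^ p`. -/
theorem mul_expDiag_mul_inv_congr {n : ℕ} {d : Fin n → ℂ} {p q E : SLC n} {t : ℂ}
    (hE : (E : Mat n) = diagonal fun i => Complex.exp (t * d i))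
    (h : conj (p : Mat n) (diagonal d) = conj (q : Mat n) (diagonal d)) :
    p * E * p⁻¹ = q * E * q⁻¹ := by
  have h1 : conj ((q⁻¹ * p : SLC n) : Mat n) (diagonal d) = diagonal d := by
    rw [conj_coe_mul, h, ← conj_coe_mul, inv_mul_cancel, conj_coe_one]
  have h2 : q⁻¹ * p * E = E * (q⁻¹ * p) := by
    apply Subtype.ext
    have h3 := mul_diagonal_exp_comm (conj_eq_iff_mul_eq.mp h1) t
    rwa [← hE, ← Matrix.SpecialLinearGroup.coe_mul, ← Matrix.SpecialLinearGroup.coe_mul] at h3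
  rw [mul_inv_eq_iff_eq_mul, mul_assoc q, mul_assoc q, mul_assoc E, ← h2]
  group

end TodaSL

open TodaSL in
theorem mainTheorem6 (n : ℕ) (O : Set (Mat n)) (hO : IsSimpleClass O)
    (Lam : Mat n) (hLam : Lam ∈ O) (hdiag : Lam.IsDiag)
    (X : Mat n) (hX : X ∈ chartDomain Lam)
    (Y Z : Mat n) (hY : Y ∈ strictLower n) (hZ : Z ∈ strictLower n)
    (k u : SLC n) (hk : k ∈ bigC n) (hu : u ∈ bigD n)
    (hXY : X = conj ((k⁻¹ : SLC n) : Mat n) (Lam + Y))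
    (hXZ : X = conj (u : Mat n) (Lam + Z)) :
    ∃ γ : ℝ → Mat n, IsTodaTrajectory X γ ∧
      (∃ lIm : ℝ → SLC n, (∀ t, lIm t ∈ L n) ∧
        ∀ t : ℝ, γ t = conj (((kappa (lIm t))⁻¹ : SLC n) : Mat n)
          (conj (NormedSpace.exp (-((t : ℂ) * Complex.I) • imPart Lam)) (Lam + Y))) ∧
      (∃ lRe : ℝ → SLC n, (∀ t, lRe t ∈ L n) ∧
        ∀ t : ℝ, γ t = conj (nu (lRe t) : Mat n)
          (conj (NormedSpace.exp ((t : ℂ) • rePart Lam)) (Lam + Z))) ∧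
      ∀ t : ℝ, γ t ∈ chartDomain Lam := by
  obtain ⟨X₀, hX₀, hspec, rfl⟩ := hO
  obtain ⟨g₀, hg₀⟩ := hLam
  obtain ⟨d, rfl⟩ : ∃ d : Fin n → ℂ, Lam = Matrix.diagonal d := ⟨_, hdiag.diagonal_diag.symm⟩
  have hinj : Function.Injective d := injective_of_hasSimpleSpectrum (by
    rw [HasSimpleSpectrum, hg₀, charpoly_conj]
    exact hspec)
  have hsum : ∑ i, d i = 0 := by
    have h1 := congrArg Matrix.trace hg₀
    rw [trace_conj, Matrix.trace_diagonal] at h1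
    exact h1.trans hX₀
  have hsumre : ∑ i, (d i).re = 0 := by rw [← Complex.re_sum, hsum, Complex.zero_re]
  have hsumim : ∑ i, (d i).im = 0 := by rw [← Complex.im_sum, hsum, Complex.zero_im]
  -- `Λ + Y = Λ ^ (l⁻¹)` and `Λ + Z = Λ ^ (m⁻¹)` with `l, m ∈ L`
  obtain ⟨k₀, -, l₀, -, hX₁⟩ := hX
  obtain ⟨l, hl, hlY⟩ := exists_mem_L_conj hinj hY (g := k * (l₀ * k₀)⁻¹) (by
    rw [conj_coe_mul, ← hX₁, conj_eq_iff.mp hXY.symm, inv_inv])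
  obtain ⟨m, hm, hmZ⟩ := exists_mem_L_conj hinj hZ (g := u⁻¹ * (l₀ * k₀)⁻¹) (by
    rw [conj_coe_mul, ← hX₁, conj_eq_iff.mp hXZ.symm])
  have hXl : X = conj ((k⁻¹ * l⁻¹ : SLC n) : Mat n) (Matrix.diagonal d) := by
    rw [conj_coe_mul, ← hlY, hXY]
  have hXm : X = conj ((u * m⁻¹ : SLC n) : Mat n) (Matrix.diagonal d) := by
    rw [conj_coe_mul, ← hmZ, hXZ]
  obtain ⟨hkK, l₁, hl₁, u₁, hu₁, hklu⟩ := hk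
  obtain ⟨huU, l₂, hl₂, k₂, hk₂, hlku⟩ := hu
  -- `exp(t Λ) = W P` with `W = exp(t i Im Λ) ∈ K` and `P = exp(t Re Λ) ∈ U`
  have hE0 : ∀ t : ℝ, ∑ i, (t : ℂ) * d i = 0 := fun t => by rw [← Finset.mul_sum, hsum, mul_zero]
  have hP0 : ∀ t : ℝ, ∑ i, (t : ℂ) * ((d i).re : ℂ) = 0 := fun t => by
    rw [← Finset.mul_sum, ← Complex.ofReal_sum, hsumre, Complex.ofReal_zero, mul_zero]
  have hW0 : ∀ t : ℝ, ∑ i, (t : ℂ) * Complex.I * ((d i).im : ℂ) = 0 := fun t => by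
    rw [← Finset.mul_sum, ← Complex.ofReal_sum, hsumim, Complex.ofReal_zero, mul_zero]
  let E : ℝ → SLC n := fun t => expDiag _ (hE0 t)
  let P : ℝ → SLC n := fun t => expDiag _ (hP0 t)
  let W : ℝ → SLC n := fun t => expDiag _ (hW0 t)
  have hE : ∀ t, (E t : Mat n) = Matrix.diagonal fun i => Complex.exp ((t : ℂ) * d i) :=
    fun t => coe_expDiag _ (hE0 t)
  have hWP : ∀ t, E t = W t * P t := by
    intro t
    refine Eq.trans ?_ (expDiag_mul (hW0 t) (hP0 t)).symm
    apply Subtype.ext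
    rw [hE, coe_expDiag]
    congr 1
    funext i
    congr 1
    conv_lhs => rw [← Complex.re_add_im (d i)]
    simp only [Pi.add_apply]
    ring
  have hPU : ∀ t, P t ∈ U n := fun t => expDiag_mem_U _ fun i => by simp
  have hWK : ∀ t, W t ∈ K n := fun t => expDiag_mem_K _ fun i => by simp
  have hWexp : ∀ t : ℝ, NormedSpace.exp (-((t : ℂ) * Complex.I) • imPart (Matrix.diagonal d))
      = (((W t)⁻¹ : SLC n) : Mat n) := by
    intro t
    rw [show (W t)⁻¹ = _ from expDiag_inv (hW0 t), coe_expDiag, ← exp_diagonal_eq, imPart,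
      Matrix.diagonal_map (by simp), ← Matrix.diagonal_smul]
    congr 2
    funext i
    simp
  have hPexp : ∀ t : ℝ, NormedSpace.exp ((t : ℂ) • rePart (Matrix.diagonal d))
      = (P t : Mat n) := by
    intro t
    rw [coe_expDiag, ← exp_diagonal_eq, rePart, Matrix.diagonal_map (by simp),
      ← Matrix.diagonal_smul]
    congr 2
  -- `G t = exp(t X)`
  let G : ℝ → SLC n := fun t => k⁻¹ * l⁻¹ * E t * (k⁻¹ * l⁻¹)⁻¹
  let lIm : ℝ → SLC n := fun t => ((W t)⁻¹ * l⁻¹ * W t) * (P t * (l * l₁) * (P t)⁻¹)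
  let lRe : ℝ → SLC n := fun t => ((W t)⁻¹ * (l₂ * m⁻¹) * W t) * (P t * m * (P t)⁻¹)
  have hlIm : ∀ t, lIm t ∈ L n := fun t => (L n).mul_mem
    (inv_expDiag_mul_mul_mem_L _ ((L n).inv_mem hl))
    (expDiag_mul_mul_inv_mem_L _ ((L n).mul_mem hl hl₁))
  have hlRe : ∀ t, lRe t ∈ L n := fun t => (L n).mul_mem
    (inv_expDiag_mul_mul_mem_L _ ((L n).mul_mem hl₂ ((L n).inv_mem hm)))
    (expDiag_mul_mul_inv_mem_L _ hm)
  -- the outer factors are in `K` and in `U`, so that `κ` and `ν` of `G t` can be read off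
  have hGIm : ∀ t, G t = k⁻¹ * W t * lIm t * (P t * u₁) := by
    intro t
    simp only [G, lIm, hWP, mul_inv_rev, inv_inv, hklu]
    group
  have hGRe : ∀ t, G t = k₂⁻¹ * W t * lRe t * (P t * u⁻¹) := by
    intro t
    have h1 : G t = u * m⁻¹ * E t * (u * m⁻¹)⁻¹ :=
      mul_expDiag_mul_inv_congr (hE t) (hXl.symm.trans hXm)
    rw [h1, ← inv_mul_eq_of_eq_mul hlku]
    simp only [lRe, hWP]
    group
  have hkap : ∀ t, kappa (G t) = k⁻¹ * W t * kappa (lIm t) := fun t => by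
    rw [hGIm, (kappa_nu_mul_mul ((K n).mul_mem ((K n).inv_mem hkK) (hWK t))
      ((U n).mul_mem (hPU t) hu₁) _).1]
  have hnu : ∀ t, nu (G t) = nu (lRe t) * (P t * u⁻¹) := fun t => by
    rw [hGRe, (kappa_nu_mul_mul ((K n).mul_mem ((K n).inv_mem hk₂) (hWK t))
      ((U n).mul_mem (hPU t) ((U n).inv_mem huU)) _).2]
  have hIm : ∀ t, conj (((kappa (G t))⁻¹ : SLC n) : Mat n) X =
      conj (((kappa (lIm t))⁻¹ : SLC n) : Mat n)
        (conj (((W t)⁻¹ : SLC n) : Mat n) (Matrix.diagonal d + Y)) := by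
    intro t
    rw [hkap, hXY, ← conj_coe_mul, ← conj_coe_mul]
    refine congrArg (fun g : SLC n => conj (g : Mat n) _) ?_
    group
  refine ⟨fun t => conj (((kappa (G t))⁻¹ : SLC n) : Mat n) X,
    isTodaTrajectory_conj_kappa hXl hE, ⟨lIm, hlIm, fun t => ?_⟩, ⟨lRe, hlRe, fun t => ?_⟩,
    fun t => ?_⟩
  · rw [hWexp]
    exact hIm t
  · -- `X` commutes with `G t`, so that `κ(G t)⁻¹` may be replaced by `κ(G t)⁻¹ G t = ν(G t)`
    have hEd : conj (E t : Mat n) (Matrix.diagonal d) = Matrix.diagonal d := by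
      rw [conj_eq_iff_mul_eq, hE, Matrix.diagonal_mul_diagonal, Matrix.diagonal_mul_diagonal]
      simp only [mul_comm]
    have h1 : conj (G t : Mat n) X = X := by
      rw [hXl, ← conj_coe_mul, show G t * (k⁻¹ * l⁻¹) = k⁻¹ * l⁻¹ * E t from
        inv_mul_cancel_right _ _, conj_coe_mul, hEd]
    have h2 : (kappa (G t))⁻¹ * G t = nu (G t) := inv_mul_eq_of_eq_mul (kappa_mul_nu _).symm
    beta_reduce
    rw [hPexp]
    conv_lhs => rw [← h1]
    rw [← conj_coe_mul, h2, hnu, hXZ, ← conj_coe_mul, ← conj_coe_mul]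
    refine congrArg (fun g : SLC n => conj (g : Mat n) _) ?_
    group
  · refine ⟨kappa (lIm t), kappa_mem_bigC (hlIm t), (W t)⁻¹ * l * W t,
      inv_expDiag_mul_mul_mem_L _ hl, ?_⟩
    have hWd : conj (W t : Mat n) (Matrix.diagonal d) = Matrix.diagonal d := by
      rw [conj_eq_iff_mul_eq, coe_expDiag, Matrix.diagonal_mul_diagonal,
        Matrix.diagonal_mul_diagonal]
      simp only [mul_comm]
    beta_reduce
    rw [hIm, hlY]
    conv_lhs => rw [← hWd]
    rw [← conj_coe_mul, ← conj_coe_mul, ← conj_coe_mul]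
    refine congrArg (fun g : SLC n => conj (g : Mat n) _) ?_
    group
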